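/- Let $p$ be a prime and let $(R,\mathfrak m,\mathbb F)$ be a two-dimensional Noetherian complete local normal domain of characteristic $0$ with finite residue field $\mathbb F$ of characteristic $p$. Let $W(\mathbb F)$ be the ring of Witt vectors of $\mathbb F$, mapped to $R$ by the unique ring homomorphism inducing the identity on residue fields. For a finitely generated torsion $R$-module $M$ put $$\operatorname{char}_R(M)=\Big(\prod_{\operatorname{ht}\mathfrak P=1}\mathfrak P^{\ell_{R_{\mathfrak P}}(M_{\mathfrak P})}\Big)^{\mathrm{rc}},$$ where $I^{\mathrm{rc}}$ denotes the reflexive closure $\operatorname{Hom}_R(\operatorname{Hom}_R(I,R),R)$ of a nonzero ideal $I$, viewed as an ideal of $R$. Let $M,N$ be finitely generated torsion $R$-modules, and let $\mathfrak q_1,\dots,\mathfrak q_k$ be the distinct height-one primes $\mathfrak q$ of $R$ with $p\notin\mathfrak q$ that occur in $\operatorname{char}_R(M)$ or $\operatorname{char}_R(N)$, i.e. with $\ell_{R_{\mathfrak q}}(M_{\mathfrak q})\neq0$ or $\ell_{R_{\mathfrak q}}(N_{\mathfrak q})\ne 0$. Fix $z_1,\dots,z_k\in R$ such that, for each $t$,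 the ideal $(p,z_t)$ is a parameter ideal of $R$, $z_t\in\mathfrak q_t$, and $z_t\notin\bigcup_{i\neq t}\mathfrak q_i$. For a sequence $\{a_n\}_{n\ge1}$ of units of $W(\mathbb F)$ put $$\mathscr L(z_i,\{a_n\})=\{(z_i+a_np^n)\;:\;n\ge1\}.$$ For every such sequence, $M/\mathbf xM$ and $N/\mathbf xN$ are finite for all but finitely many ideals $(\mathbf x)\in\bigcup_{i=1}^k\mathscr L(z_i,\{a_n\})$, and the following are equivalent: (a) $\operatorname{char}_R(N)_{\mathfrak q}\subseteq\operatorname{char}_R(M)_{\mathfrak q}$ for every height-one prime $\mathfrak q$ of $R$ with $p\notin\mathfrak q$; (b) there is an integer $c\geq 1$ such that $c\cdot\dfrac{|N/\mathbf xN|}{|M/\mathbf xM|}$ is an integer for all but finitely many ideals $(\mathbf x)\in\bigcup_{i=1}^k\mathscr L(z_i,\{a_n\})$. Moreover, if (a) holds, then the constant $c$ in (b) can be chosen independently of the sequence $\{a_n\}$ (the finite set of exceptional ideals may depend on it). -/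

import Mathlib

namespace Specialization

open IsLocalRing

noncomputable section

section CoefficientRing

theorem strictMono_add_one : StrictMono fun n : ℕ => n + 1 :=
  fun _ _ h => Nat.succ_lt_succ h

theorem natCast_mem_maximalIdeal (R : Type*) [CommRing R] [IsLocalRing R] (p : ℕ)
    [CharP (ResidueField R) p] : (p : R) ∈ maximalIdeal R := by
  rw [← residue_eq_zero_iff, map_natCast, CharP.cast_eq_zero]

variable (R : Type*) [CommRing R] [IsLocalRing R] (p : ℕ) [Fact p.Prime]
  [CharP (ResidueField R) p]

/-- The kernel of `W(R) → W(R/𝔪)` is killed by `W(R) → R → R/𝔪ⁿ⁺¹`, where the first map is the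
`n`-th ghost component. -/
theorem ker_map_le_ker_ghostComponent (n : ℕ) :
    RingHom.ker (WittVector.map (p := p) (residue R)) ≤
      RingHom.ker ((Ideal.Quotient.mk (maximalIdeal R ^ (n + 1))).comp
        (WittVector.ghostComponent (p := p) n)) := by
  intro x hx
  have hx' : ∀ i, x.coeff i ∈ maximalIdeal R := by
    intro i
    rw [RingHom.mem_ker] at hx
    have := congrArg (fun y => WittVector.coeff y i) hx
    simpa [WittVector.map_coeff] using this
  rw [RingHom.mem_ker, RingHom.comp_apply, Ideal.Quotient.eq_zero_iff_mem,
    WittVector.ghostComponent_apply, wittPolynomial_eq_sum_C_mul_X_pow]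
  simp only [map_sum, map_mul, map_pow, MvPolynomial.aeval_C, MvPolynomial.aeval_X]
  refine Ideal.sum_mem _ fun i hi => ?_
  have hin : i ≤ n := Nat.lt_succ_iff.mp (Finset.mem_range.mp hi)
  have h1 : n + 1 ≤ i + p ^ (n - i) := by
    have := Nat.lt_pow_self (n := n - i) (Fact.out : p.Prime).one_lt
    omega
  refine Ideal.pow_le_pow_right h1 ?_
  rw [pow_add]
  refine Ideal.mul_mem_mul ?_ (Ideal.pow_mem_pow (hx' i) _)
  have := Ideal.pow_mem_pow (natCast_mem_maximalIdeal R p) i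
  simpa using this

/-- The ring map `W(R/𝔪) → R/𝔪ⁿ⁺¹` induced by the `n`-th ghost component `W(R) → R`. -/
def ghostComponentMod (n : ℕ) :
    WittVector p (ResidueField R) →+* R ⧸ maximalIdeal R ^ (n + 1) :=
  RingHom.liftOfSurjective (WittVector.map (residue R))
    (WittVector.map_surjective _ residue_surjective)
    ⟨(Ideal.Quotient.mk (maximalIdeal R ^ (n + 1))).comp (WittVector.ghostComponent n),
      ker_map_le_ker_ghostComponent R p n⟩

theorem ghostComponentMod_map (n : ℕ) (x : WittVector p R) :
    ghostComponentMod R p n (WittVector.map (residue R) x) =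
      Ideal.Quotient.mk _ (WittVector.ghostComponent n x) :=
  RingHom.liftOfSurjective_comp_apply ..

variable [PerfectRing (ResidueField R) p]

/-- The canonical ring map `W(R/𝔪) → R/𝔪ⁿ⁺¹`, for `R/𝔪` perfect: the composition of the inverse
of the `n`-th power of the Witt vector Frobenius with `ghostComponentMod`. -/
def wittMapMod (n : ℕ) : WittVector p (ResidueField R) →+* R ⧸ maximalIdeal R ^ (n + 1) :=
  (ghostComponentMod R p n).comp (WittVector.map
    ((iterateFrobeniusEquiv (ResidueField R) p n).symm : ResidueField R →+* ResidueField R))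

theorem wittMapMod_teichmuller (n : ℕ) (a : ResidueField R) (b : R)
    (hb : residue R b ^ p ^ n = a) :
    wittMapMod R p n (WittVector.teichmuller p a) = Ideal.Quotient.mk _ (b ^ p ^ n) := by
  have h : (iterateFrobeniusEquiv (ResidueField R) p n).symm a = residue R b := by
    rw [RingEquiv.symm_apply_eq, iterateFrobeniusEquiv_def, hb]
  rw [wittMapMod, RingHom.comp_apply, WittVector.map_teichmuller, RingHom.coe_coe, h,
    ← WittVector.map_teichmuller, ghostComponentMod_map, WittVector.ghostComponent_teichmuller]

theorem factorPow_comp_wittMapMod (n : ℕ) :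
    (Ideal.Quotient.factorPow (maximalIdeal R) (strictMono_add_one.monotone n.le_succ)).comp
      (wittMapMod R p (n + 1)) = wittMapMod R p n := by
  refine WittVector.eq_of_apply_teichmuller_eq (p := p) _ _ ⟨n + 1, ?_⟩ fun a => ?_
  · have : (p : R ⧸ maximalIdeal R ^ (n + 1)) = Ideal.Quotient.mk _ (p : R) := by simp
    rw [this, ← map_pow, Ideal.Quotient.eq_zero_iff_mem]
    exact Ideal.pow_mem_pow (natCast_mem_maximalIdeal R p) _
  · obtain ⟨b, hb⟩ := residue_surjective ((iterateFrobeniusEquiv (ResidueField R) p (n + 1)).symm a)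
    have hb' : residue R b ^ p ^ (n + 1) = a := by
      rw [hb, ← iterateFrobeniusEquiv_def, RingEquiv.apply_symm_apply]
    rw [RingHom.comp_apply, wittMapMod_teichmuller R p (n + 1) a b hb',
      wittMapMod_teichmuller R p n a (b ^ p) (by rw [map_pow, ← pow_mul, ← pow_succ', hb'])]
    rw [← pow_mul, ← pow_succ']
    rfl

variable [IsAdicComplete (maximalIdeal R) R]

/-- The canonical ring map `W(R/𝔪) → R` of a complete local ring with perfect residue field of
characteristic `p`. -/
def wittMap : WittVector p (ResidueField R) →+* R :=
  IsAdicComplete.StrictMono.liftRingHom (maximalIdeal R) strictMono_add_one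
    (wittMapMod R p) (factorPow_comp_wittMapMod R p _)

/-- `wittMap` induces the identity on residue fields. -/
theorem residue_comp_wittMap :
    (residue R).comp (wittMap R p) = WittVector.constantCoeff := by
  ext x
  obtain ⟨y, rfl⟩ := WittVector.map_surjective (p := p) _ (residue_surjective (R := R)) x
  have h := IsAdicComplete.StrictMono.mk_liftRingHom (maximalIdeal R) strictMono_add_one
    (wittMapMod R p) (factorPow_comp_wittMapMod R p _) (n := 0)
    (WittVector.map (residue R) y)
  have h0 : wittMapMod R p 0 (WittVector.map (residue R) y) =
      Ideal.Quotient.mk _ (y.coeff 0) := by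
    have : WittVector.map ((iterateFrobeniusEquiv (ResidueField R) p 0).symm :
        ResidueField R →+* ResidueField R) (WittVector.map (residue R) y) =
        WittVector.map (residue R) y := by
      ext i
      simp only [WittVector.map_coeff, RingHom.coe_coe]
      rw [RingEquiv.symm_apply_eq, iterateFrobeniusEquiv_def]
      simp
    rw [wittMapMod, RingHom.comp_apply, this, ghostComponentMod_map]
    simp [WittVector.ghostComponent_apply]
  rw [h0] at h
  change Ideal.Quotient.mk (maximalIdeal R ^ (0 + 1)) (wittMap R p _) = _ at h
  rw [Ideal.Quotient.eq, zero_add, pow_one, ← residue_eq_zero_iff, map_sub, sub_eq_zero] at h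
  simpa [WittVector.constantCoeff] using h

/-- `wittMap` is the only ring map `W(R/𝔪) → R` that induces the identity on residue fields. -/
theorem eq_wittMap (f : WittVector p (ResidueField R) →+* R)
    (hf : (residue R).comp f = WittVector.constantCoeff) : f = wittMap R p := by
  refine IsAdicComplete.StrictMono.eq_liftRingHom (maximalIdeal R) strictMono_add_one
    (wittMapMod R p) (factorPow_comp_wittMapMod R p _) fun n => ?_
  refine WittVector.eq_of_apply_teichmuller_eq (p := p) _ _ ⟨n + 1, ?_⟩ fun a => ?_
  · have : (p : R ⧸ maximalIdeal R ^ (n + 1)) = Ideal.Quotient.mk _ (p : R) := by simp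
    change (p : R ⧸ maximalIdeal R ^ (n + 1)) ^ (n + 1) = 0
    rw [this, ← map_pow, Ideal.Quotient.eq_zero_iff_mem]
    exact Ideal.pow_mem_pow (natCast_mem_maximalIdeal R p) _
  · obtain ⟨c, rfl⟩ := (iterateFrobeniusEquiv (ResidueField R) p n).surjective a
    have hc : residue R (f (WittVector.teichmuller p c)) = c := by
      have := RingHom.congr_fun hf (WittVector.teichmuller p c)
      simpa [WittVector.constantCoeff, WittVector.teichmuller_coeff_zero] using this
    rw [iterateFrobeniusEquiv_def]
    refine Eq.trans ?_ (wittMapMod_teichmuller R p n (c ^ p ^ n)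
      (f (WittVector.teichmuller p c)) (by rw [hc])).symm
    rw [RingHom.comp_apply, map_pow, map_pow]

end CoefficientRing

section CharacteristicIdeal

variable (R : Type*) [CommRing R]

/-- The length of the localization `M_P` over `R_P`. -/
def localLength (M : Type*) [AddCommGroup M] [Module R M] (P : Ideal R) [P.IsPrime] : ℕ :=
  (Module.length (Localization.AtPrime P) (LocalizedModule P.primeCompl M)).toNat

variable {R} in
/-- The reflexive closure of an ideal `I` of a domain `R` with fraction field `K`, as an ideal of
`R`: the elements of `R` lying in `R : (R : I)`, the fractional ideal to which the double dual
`Hom(Hom(I, R), R)` of a nonzero ideal `I` is identified inside `K`. -/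
def reflexiveClosure [IsDomain R] (I : Ideal R) : Ideal R :=
  ((1 / (1 / (I : FractionalIdeal (nonZeroDivisors R) (FractionRing R))) :
    FractionalIdeal (nonZeroDivisors R) (FractionRing R)) :
      Submodule R (FractionRing R)).comap (Algebra.linearMap R (FractionRing R))

open Classical in
/-- The characteristic ideal of `M`: the reflexive closure of the product of the
`P ^ length (M_P)` over all height-one primes `P` if `M` is torsion, and `0` otherwise. -/
def charIdeal [IsDomain R] (M : Type*) [AddCommGroup M] [Module R M] : Ideal R :=
  if Module.IsTorsion R M then
    reflexiveClosure (∏ᶠ P : {P : PrimeSpectrum R // P.asIdeal.height = 1},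
      P.1.asIdeal ^ localLength R M P.1.asIdeal)
  else ⊥

/-- `char(N)_P ⊆ char(M)_P` for all height-one primes `P` of `R` that do not contain `p`. -/
def CharIdealLEOutside [IsDomain R] (p : ℕ) (N M : Type*) [AddCommGroup N] [Module R N]
    [AddCommGroup M] [Module R M] : Prop :=
  ∀ P : PrimeSpectrum R, P.asIdeal.height = 1 → (p : R) ∉ P.asIdeal →
    (charIdeal R N).map (algebraMap R (Localization.AtPrime P.asIdeal)) ≤
      (charIdeal R M).map (algebraMap R (Localization.AtPrime P.asIdeal))

end CharacteristicIdeal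

section Specialization

/-- `(x, y)` is a parameter ideal of the local ring `R`, assumed of dimension two. -/
def IsParameterPair {R : Type*} [CommRing R] [IsLocalRing R] (x y : R) : Prop :=
  (Ideal.span {x, y}).radical = maximalIdeal R

variable {R : Type*} [CommRing R] [IsLocalRing R] (p : ℕ) [Fact p.Prime]
  [CharP (ResidueField R) p] [PerfectRing (ResidueField R) p] [IsAdicComplete (maximalIdeal R) R]

/-- The set of principal ideals `(z + aₙ pⁿ)`, `n = 1, 2, 3, …`, where `aₙ` is a unit of
`W(R/𝔪)`. -/
def specializationIdeals (z : R) (a : ℕ → (WittVector p (ResidueField R))ˣ) : Set (Ideal R) :=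
  {I | ∃ n : ℕ, 0 < n ∧ I = Ideal.span {z + wittMap R p (a n) * (p : R) ^ n}}

end Specialization

/-- `c · |N/IN| / |M/IM|` is a natural number. -/
def IsIntegralRatio {R : Type*} [CommRing R] (M N : Type*) [AddCommGroup M] [Module R M]
    [AddCommGroup N] [Module R N] (c : ℕ) (I : Ideal R) : Prop :=
  ∃ m : ℕ, (c : ℚ) * ((Nat.card (N ⧸ (I • ⊤ : Submodule R N)) : ℚ) /
    (Nat.card (M ⧸ (I • ⊤ : Submodule R M)) : ℚ)) = m

end

end Specialization

/-! Fix `t`, put `q = q t`, and let `d` be the length of `R/(q + (p))`, which is positive and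
finite. The theorem rests on one estimate: for units `u` and large `n`, the element `x = z t + u pⁿ`
satisfies `length (M/xM) = n · d · length (M_q) + O(1)`, with an error uniform in `n` and `u`
(`hasLinearSpecialization`). The same holds for `N`. Since a module of finite length has `|𝔽| ^
length` elements, `|N/xN| / |M/xM|` is `|𝔽|` to the power `n · d · (length N_q - length M_q) +
O(1)`. A bounded denominator for all large `n` therefore means `length M_q ≤ length N_q`. Uniformity
in `u` makes the constant independent of the sequence of units.

The estimate is proved by dévissage to `R/P` with `P` a nonzero prime in the support. If `P = q`,
then `x` is `u pⁿ` modulo `q`, and the length is exactly `n d`. If `z t ∉ P`, then `x` is a unit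
times `z t` modulo `P` for large `n`, so the length is constant. The conditions on `z t` leave only
`P = 𝔪`, where the length is at most one. Reduction modulo `x` is not exact, so the induction also
carries a bound on the `x`-torsion.

On the ideal side, `R_P` is a discrete valuation ring for `P` of height one, and the characteristic
ideal becomes the maximal ideal to the power `length M_P` (`map_charIdeal`). Condition (a) is thus
an inequality of lengths. Finally, distinct `n` give distinct ideals (`span_add_mul_pow_ne`), so
"all but finitely many ideals" means "all large `n`". -/

namespace Specialization

open IsLocalRing
open scoped Pointwise nonZeroDivisors

/-! ### Lengths, quotients by one element, and localization -/

section Length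

variable {R : Type*} [CommRing R]

theorem exact_lsmul_mkQ (x : R) (A : Type*) [AddCommGroup A] [Module R A] :
    Function.Exact (LinearMap.lsmul R A x) (x • (⊤ : Submodule R A)).mkQ := by
  rw [LinearMap.exact_iff, Submodule.ker_mkQ]
  ext d
  simp [Submodule.mem_smul_pointwise_iff_exists]

/-- Left exactness of `x`-torsion; this keeps the torsion bound alive through the dévissage. -/
theorem length_ker_lsmul_le {A B C : Type*} [AddCommGroup A] [Module R A] [AddCommGroup B]
    [Module R B] [AddCommGroup C] [Module R C] {f : A →ₗ[R] B} {g : B →ₗ[R] C}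
    (hf : Function.Injective f) (h : Function.Exact f g) (x : R) :
    Module.length R (LinearMap.ker (LinearMap.lsmul R B x)) ≤
      Module.length R (LinearMap.ker (LinearMap.lsmul R A x)) +
        Module.length R (LinearMap.ker (LinearMap.lsmul R C x)) := by
  let g' : LinearMap.ker (LinearMap.lsmul R B x) →ₗ[R] LinearMap.ker (LinearMap.lsmul R C x) :=
    g.restrict fun b hb => by
      simp only [LinearMap.mem_ker, LinearMap.lsmul_apply] at hb ⊢
      rw [← map_smul, hb, map_zero]
  rw [Module.length_eq_add_of_exact (LinearMap.ker g').subtype g'.rangeRestrict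
    (Submodule.subtype_injective _) g'.surjective_rangeRestrict
    (by rw [LinearMap.exact_iff, LinearMap.ker_rangeRestrict, Submodule.range_subtype])]
  refine add_le_add ?_ (Module.length_le_of_injective _ (Submodule.subtype_injective _))
  have hmem : ∀ b : LinearMap.ker g', ∃ a : LinearMap.ker (LinearMap.lsmul R A x),
      f a = (b : B) := by
    rintro ⟨⟨b, hb⟩, hb'⟩
    have hgb : g b = 0 := congrArg Subtype.val hb'
    obtain ⟨a, rfl⟩ := (h b).1 hgb
    refine ⟨⟨a, ?_⟩, rfl⟩
    simp only [LinearMap.mem_ker, LinearMap.lsmul_apply] at hb ⊢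
    exact hf (by rw [map_smul, hb, map_zero])
  choose s hs using hmem
  let s' : LinearMap.ker g' →ₗ[R] LinearMap.ker (LinearMap.lsmul R A x) :=
    { toFun := s
      map_add' := fun b c => Subtype.ext (hf (by simp [hs]))
      map_smul' := fun r b => Subtype.ext (hf (by simp [hs])) }
  refine Module.length_le_of_injective s' fun b c hbc => ?_
  have : s b = s c := hbc
  exact Subtype.ext (Subtype.ext (by rw [← hs b, ← hs c, this]))

theorem length_quotSMulTop_le {A B C : Type*} [AddCommGroup A] [Module R A] [AddCommGroup B]
    [Module R B] [AddCommGroup C] [Module R C] {f : A →ₗ[R] B} {g : B →ₗ[R] C}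
    (hg : Function.Surjective g) (h : Function.Exact f g) (x : R) :
    Module.length R (QuotSMulTop x B) ≤
      Module.length R (QuotSMulTop x A) + Module.length R (QuotSMulTop x C) := by
  let f' := QuotSMulTop.map x f
  let g' := QuotSMulTop.map x g
  have hex : Function.Exact f' g' := QuotSMulTop.map_exact x h hg
  rw [Module.length_eq_add_of_exact (LinearMap.range f').subtype g'
    (Submodule.subtype_injective _) (QuotSMulTop.map_surjective x hg)
    (by rw [LinearMap.exact_iff, Submodule.range_subtype, hex.linearMap_ker_eq])]
  gcongr
  exact Module.length_le_of_surjective _ f'.surjective_rangeRestrict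

/-- By the snake lemma, the kernel of `A/xA → B/xB` is the image of the `x`-torsion of `C`, so the
failure of additivity is at most the length of that torsion. -/
theorem length_quotSMulTop_add_le {A B C : Type*} [AddCommGroup A] [Module R A] [AddCommGroup B]
    [Module R B] [AddCommGroup C] [Module R C] {f : A →ₗ[R] B} {g : B →ₗ[R] C}
    (hf : Function.Injective f) (hg : Function.Surjective g) (h : Function.Exact f g) (x : R) :
    Module.length R (QuotSMulTop x A) + Module.length R (QuotSMulTop x C) ≤
      Module.length R (QuotSMulTop x B) +
        Module.length R (LinearMap.ker (LinearMap.lsmul R C x)) := by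
  let f' := QuotSMulTop.map x f
  let g' := QuotSMulTop.map x g
  have hex : Function.Exact f' g' := QuotSMulTop.map_exact x h hg
  rw [Module.length_eq_add_of_exact (LinearMap.range f').subtype g'
    (Submodule.subtype_injective _) (QuotSMulTop.map_surjective x hg)
    (by rw [LinearMap.exact_iff, Submodule.range_subtype, hex.linearMap_ker_eq]),
    Module.length_eq_add_of_exact (LinearMap.ker f').subtype f'.rangeRestrict
    (Submodule.subtype_injective _) f'.surjective_rangeRestrict
    (by rw [LinearMap.exact_iff, LinearMap.ker_rangeRestrict, Submodule.range_subtype])]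
  have hker : Function.Exact (LinearMap.ker (LinearMap.lsmul R C x)).subtype
      (LinearMap.lsmul R C x) := by
    rw [LinearMap.exact_iff, Submodule.range_subtype]
  have h₁ : f ∘ₗ LinearMap.lsmul R A x = LinearMap.lsmul R B x ∘ₗ f := by ext; simp
  have h₂ : g ∘ₗ LinearMap.lsmul R B x = LinearMap.lsmul R C x ∘ₗ g := by ext; simp
  have hδ := SnakeLemma.exact_δ'_left (LinearMap.lsmul R A x) (LinearMap.lsmul R B x)
    (LinearMap.lsmul R C x) f g h f g h h₁ h₂ _ hker
    _ (exact_lsmul_mkQ x A) _ (exact_lsmul_mkQ x B) hg hf f'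
    (by ext; rfl) (Submodule.mkQ_surjective _)
  set δ := SnakeLemma.δ' (LinearMap.lsmul R A x) (LinearMap.lsmul R B x)
    (LinearMap.lsmul R C x) f g h f g h h₁ h₂ _ hker _ (exact_lsmul_mkQ x A) hg hf
  have hle : Module.length R (LinearMap.ker f') ≤
      Module.length R (LinearMap.ker (LinearMap.lsmul R C x)) := by
    rw [hδ.linearMap_ker_eq]
    exact Module.length_le_of_surjective _ δ.surjective_rangeRestrict
  calc _ = Module.length R (LinearMap.range f') + Module.length R (QuotSMulTop x C) +
        Module.length R (LinearMap.ker f') := by ring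
    _ ≤ _ := by gcongr

/-- The length of `M_q` over `R_q` is additive in short exact sequences. -/
theorem length_localizedModule_of_exact (q : Ideal R) [q.IsPrime] {A B C : Type*}
    [AddCommGroup A] [Module R A] [AddCommGroup B] [Module R B] [AddCommGroup C] [Module R C]
    {f : A →ₗ[R] B} {g : B →ₗ[R] C}
    (hf : Function.Injective f) (hg : Function.Surjective g) (h : Function.Exact f g) :
    Module.length (Localization.AtPrime q) (LocalizedModule q.primeCompl B) =
      Module.length (Localization.AtPrime q) (LocalizedModule q.primeCompl A) +
        Module.length (Localization.AtPrime q) (LocalizedModule q.primeCompl C) :=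
  Module.length_eq_add_of_exact (LocalizedModule.map q.primeCompl f)
    (LocalizedModule.map q.primeCompl g) (LocalizedModule.map_injective _ f hf)
    (LocalizedModule.map_surjective _ g hg) (LocalizedModule.map_exact _ f g h)

theorem length_localizedModule_congr (q : Ideal R) [q.IsPrime] {A B : Type*}
    [AddCommGroup A] [Module R A] [AddCommGroup B] [Module R B] (e : A ≃ₗ[R] B) :
    Module.length (Localization.AtPrime q) (LocalizedModule q.primeCompl A) =
      Module.length (Localization.AtPrime q) (LocalizedModule q.primeCompl B) :=
  (IsLocalizedModule.mapEquiv q.primeCompl (LocalizedModule.mkLinearMap q.primeCompl A)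
    (LocalizedModule.mkLinearMap q.primeCompl B) (Localization.AtPrime q) e).length_eq

theorem length_localizedModule_eq_zero (q : PrimeSpectrum R) {A : Type*} [AddCommGroup A]
    [Module R A] (h : q ∉ Module.support R A) :
    Module.length (Localization.AtPrime q.asIdeal) (LocalizedModule q.asIdeal.primeCompl A) =
      0 := by
  rw [Module.length_eq_zero_iff]
  exact Module.notMem_support_iff.1 h

theorem length_localizedModule_quotient_self (q : Ideal R) [q.IsPrime] :
    Module.length (Localization.AtPrime q) (LocalizedModule q.primeCompl (R ⧸ q)) = 1 := by
  rw [Module.length_eq_one_iff]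
  have hnt : Nontrivial (LocalizedModule q.primeCompl (R ⧸ q)) := by
    have : (⟨q, ‹_›⟩ : PrimeSpectrum R) ∈ Module.support R (R ⧸ q) := by
      rw [Module.mem_support_iff_of_finite, Ideal.annihilator_quotient]
    exact Module.mem_support_iff.1 this
  rw [isSimpleModule_iff_toSpanSingleton_surjective]
  refine ⟨hnt, fun w hw v => ?_⟩
  induction w using LocalizedModule.induction_on with | _ m s
  induction v using LocalizedModule.induction_on with | _ m' s'
  obtain ⟨r, rfl⟩ := Ideal.Quotient.mk_surjective m
  obtain ⟨r', rfl⟩ := Ideal.Quotient.mk_surjective m'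
  have hr : r ∈ q.primeCompl := fun hr => hw (by
    rw [Ideal.Quotient.eq_zero_iff_mem.2 hr, LocalizedModule.zero_mk])
  -- The scalar is the quotient of `r'/s'` by `r/s`, which exists because `r ∉ q`.
  refine ⟨Localization.mk (r' * s) (s' * ⟨r, hr⟩), ?_⟩
  rw [LinearMap.toSpanSingleton_apply, LocalizedModule.mk_smul_mk, LocalizedModule.mk_eq]
  refine ⟨1, ?_⟩
  simp only [one_smul, Submonoid.smul_def, Submonoid.coe_mul]
  change Ideal.Quotient.mk q _ = Ideal.Quotient.mk q _
  simp only [smul_eq_mul]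
  congr 1
  ring

/-- Length over `R` and over `R/P` agree because `R → R/P` is surjective; the multiplicativity of
`Ring.ord` then becomes available. -/
theorem length_quotSMulTop_quotient (P : Ideal R) (x : R) :
    Module.length R (QuotSMulTop x (R ⧸ P)) = Ring.ord (R ⧸ P) (Ideal.Quotient.mk P x) := by
  have : (x • (⊤ : Submodule R (R ⧸ P))) =
      (Ideal.span {Ideal.Quotient.mk P x}).restrictScalars R := by
    ext y
    simp only [Submodule.mem_smul_pointwise_iff_exists, Submodule.mem_top, true_and,
      Submodule.restrictScalars_mem, Ideal.mem_span_singleton', Algebra.smul_def]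
    exact exists_congr fun a => by rw [mul_comm]; rfl
  rw [(Submodule.quotEquivOfEq _ _ this).length_eq]
  exact Module.length_eq_of_surjective (S := R) (R := R ⧸ P)
    (M := (R ⧸ P) ⧸ Ideal.span {Ideal.Quotient.mk P x}) Ideal.Quotient.mk_surjective

theorem length_ker_lsmul_quotient_eq_zero (P : Ideal R) [P.IsPrime] {x : R} (hx : x ∉ P)
    {A : Type*} [AddCommGroup A] [Module R A] (e : A ≃ₗ[R] R ⧸ P) :
    Module.length R (LinearMap.ker (LinearMap.lsmul R A x)) = 0 := by
  rw [Module.length_eq_zero_iff, Submodule.subsingleton_iff_eq_bot, LinearMap.ker_eq_bot']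
  intro m hm
  have h := congrArg e hm
  rw [LinearMap.lsmul_apply, map_smul, map_zero, Algebra.smul_def, mul_eq_zero] at h
  rcases h with h | h
  · exact absurd (Ideal.Quotient.eq_zero_iff_mem.1 h) hx
  · exact e.map_eq_zero_iff.1 h

/-- A module of finite length over a local ring with finite residue field `F` has
`|F| ^ length` elements. -/
theorem finite_and_card_of_length_ne_top [IsLocalRing R] [Finite (ResidueField R)] {M : Type*}
    [AddCommGroup M] [Module R M] (h : Module.length R M ≠ ⊤) :
    Finite M ∧ Nat.card M = Nat.card (ResidueField R) ^ (Module.length R M).toNat := by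
  rw [Module.length_ne_top_iff] at h
  induction h with
  | of_subsingleton => exact ⟨inferInstance, by simp [Module.length_eq_zero]⟩
  | @of_simple_quotient M _ _ N hs hN ih =>
    obtain ⟨I, hI, ⟨e⟩⟩ := isSimpleModule_iff_quot_maximal.1 hs
    obtain rfl := IsLocalRing.eq_maximalIdeal hI
    obtain ⟨h1, h2⟩ := ih
    have e' : (M ⧸ N) ≃ ResidueField R := e.toEquiv
    have hf : Finite (M ⧸ N) := Finite.of_equiv _ e'.symm
    have hf' : Finite (M ⧸ N.toAddSubgroup) := hf
    have hfN : Finite N.toAddSubgroup := h1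
    have hfM : Finite M := Finite.of_equiv _ (AddSubgroup.addGroupEquivQuotientProdAddSubgroup
      (s := N.toAddSubgroup)).symm
    refine ⟨hfM, ?_⟩
    rw [Submodule.card_eq_card_quotient_mul_card N,
      Module.length_eq_add_of_exact N.subtype N.mkQ N.subtype_injective N.mkQ_surjective
      (LinearMap.exact_subtype_mkQ N), Module.length_eq_one R (M ⧸ N),
      ENat.toNat_add (Module.length_ne_top_iff.2 hN) (by simp), pow_add, ← h2,
      Nat.card_congr e']
    simp [mul_comm]

end Length

/-! ### Linear growth of the length of `M / (z + u pⁿ) M` -/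

section Asymptotics

variable {R : Type*} [CommRing R]

/-- Dividing a domain by a nonzero element of `P` already lowers the dimension by one. -/
theorem krullDimLE_one_quotient [IsDomain R] (hdim : ringKrullDim R = 2) {P : Ideal R}
    (hP : P ≠ ⊥) : Ring.KrullDimLE 1 (R ⧸ P) := by
  obtain ⟨r, hrP, hr⟩ := Submodule.exists_mem_ne_zero_of_ne_bot hP
  have h1 := ringKrullDim_quotient_succ_le_of_nonZeroDivisor (mem_nonZeroDivisors_of_ne_zero hr)
  have hle : Ideal.span {r} ≤ P := (Ideal.span_singleton_le_iff_mem _).2 hrP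
  have h2 := ringKrullDim_le_of_surjective (Ideal.Quotient.factor hle)
    (Ideal.Quotient.factor_surjective hle)
  rw [Ring.KrullDimLE, Order.krullDimLE_iff, ← ENat.WithBot.add_le_add_one_right_iff]
  calc ringKrullDim (R ⧸ P) + 1 ≤ ringKrullDim (R ⧸ Ideal.span {r}) + 1 := by gcongr
    _ ≤ _ := h1.trans (by rw [hdim]; rfl)

/-- A prime containing `P` and `z` is nonzero in `R/P`, which has dimension at most one; so it is
the maximal ideal and contains `p`. -/
theorem mem_radical_sup_span [IsLocalRing R] {P : Ideal R} [P.IsPrime] [Ring.KrullDimLE 1 (R ⧸ P)]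
    {p z : R} (hp : p ∈ maximalIdeal R) (hz : z ∉ P) : p ∈ (P ⊔ Ideal.span {z}).radical := by
  rw [Ideal.radical_eq_sInf, Submodule.mem_sInf]
  intro (Q : Ideal R) ⟨hQ, hQp⟩
  have hPQ : P ≤ Q := le_sup_left.trans hQ
  have hzQ : z ∈ Q := hQ (Ideal.mem_sup_right (Ideal.mem_span_singleton_self z))
  have hprime : (Q.map (Ideal.Quotient.mk P)).IsPrime :=
    Ideal.map_isPrime_of_surjective Ideal.Quotient.mk_surjective (by rwa [Ideal.mk_ker])
  have hne : Q.map (Ideal.Quotient.mk P) ≠ ⊥ := by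
    intro h
    have := Ideal.mem_map_of_mem (Ideal.Quotient.mk P) hzQ
    rw [h, Ideal.mem_bot, Ideal.Quotient.eq_zero_iff_mem] at this
    exact hz this
  have hmax := hprime.isMaximal_of_ne_bot hne
  have := Ideal.comap_isMaximal_of_surjective (Ideal.Quotient.mk P) Ideal.Quotient.mk_surjective
    (K := Q.map (Ideal.Quotient.mk P))
  rw [Ideal.comap_map_mk hPQ] at this
  rwa [IsLocalRing.eq_maximalIdeal this]

/-- Modulo a prime `P` of coheight one with `z ∉ P`, the element `z + u pⁿ` is associated to `z`
for `n` large enough. -/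
theorem exists_mk_add_mul_pow_eq [IsLocalRing R] {P : Ideal R} [P.IsPrime]
    [Ring.KrullDimLE 1 (R ⧸ P)] {p z : R} (hp : p ∈ maximalIdeal R) (hz : z ∉ P) :
    ∃ N : ℕ, ∀ n, N ≤ n → ∀ u : R, ∃ v : R ⧸ P, IsUnit v ∧
      Ideal.Quotient.mk P (z + u * p ^ n) = Ideal.Quotient.mk P z * v := by
  obtain ⟨k, hk⟩ := mem_radical_sup_span hp hz
  obtain ⟨a, ha, b, hb, hab⟩ := Submodule.mem_sup.1 hk
  obtain ⟨y, rfl⟩ := Ideal.mem_span_singleton'.1 hb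
  -- From `p ^ k = a + y z` with `a ∈ P` one gets `z + u pⁿ ≡ z (1 + u y p ^ (n - k))` modulo `P`.
  -- Taking `n > k` puts the second summand in the maximal ideal, so the factor is a unit.
  refine ⟨k + 1, fun n hn u => ⟨Ideal.Quotient.mk P (1 + u * y * p ^ (n - k)), ?_, ?_⟩⟩
  · refine IsUnit.map _ (by_contra fun h => ?_)
    have h1 : u * y * p ^ (n - k) ∈ maximalIdeal R :=
      Ideal.mul_mem_left _ _ (Ideal.pow_mem_of_mem _ hp _ (by omega))
    have h2 : (1 : R) ∈ maximalIdeal R := by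
      have := Ideal.sub_mem _ ((mem_maximalIdeal _).2 h) h1
      rwa [add_sub_cancel_right] at this
    exact (Ideal.ne_top_iff_one _).1 (maximalIdeal.isMaximal R).ne_top h2
  · rw [← map_mul, Ideal.Quotient.eq]
    have : p ^ n = p ^ k * p ^ (n - k) := by rw [← pow_add]; congr 1; omega
    rw [this, ← hab]
    have : z + u * ((a + y * z) * p ^ (n - k)) - z * (1 + u * y * p ^ (n - k)) =
      u * p ^ (n - k) * a := by ring
    rw [this]
    exact Ideal.mul_mem_left _ _ ha

/-- Up to a bounded error, the length of `M / (z + u pⁿ) M` is `n` times the length of `M_q` times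
the order of `p` in `R / q`. -/
def HasLinearSpecialization (q : Ideal R) [q.IsPrime] (p z : R) (M : Type*) [AddCommGroup M]
    [Module R M] : Prop :=
  ∃ K N : ℕ, ∀ n, N ≤ n → ∀ u : R, IsUnit u →
    Module.length R (LinearMap.ker (LinearMap.lsmul R M (z + u * p ^ n))) ≤ K ∧
    Module.length R (QuotSMulTop (z + u * p ^ n) M) ≤
      n * Ring.ord (R ⧸ q) (Ideal.Quotient.mk q p) *
        Module.length (Localization.AtPrime q) (LocalizedModule q.primeCompl M) + K ∧
    n * Ring.ord (R ⧸ q) (Ideal.Quotient.mk q p) *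
        Module.length (Localization.AtPrime q) (LocalizedModule q.primeCompl M) ≤
      Module.length R (QuotSMulTop (z + u * p ^ n) M) + K

theorem HasLinearSpecialization.of_exact {q : Ideal R} [q.IsPrime] {p z : R} {A B C : Type*}
    [AddCommGroup A] [Module R A] [AddCommGroup B] [Module R B] [AddCommGroup C] [Module R C]
    {f : A →ₗ[R] B} {g : B →ₗ[R] C} (hf : Function.Injective f) (hg : Function.Surjective g)
    (h : Function.Exact f g) (hA : HasLinearSpecialization q p z A)
    (hC : HasLinearSpecialization q p z C) : HasLinearSpecialization q p z B := by
  obtain ⟨K₁, N₁, h₁⟩ := hA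
  obtain ⟨K₂, N₂, h₂⟩ := hC
  -- The second `K₂` pays for the `x`-torsion of `C` in the lower bound.
  refine ⟨K₁ + K₂ + K₂, max N₁ N₂, fun n hn u hu => ?_⟩
  obtain ⟨a₁, b₁, c₁⟩ := h₁ n (le_of_max_le_left hn) u hu
  obtain ⟨a₂, b₂, c₂⟩ := h₂ n (le_of_max_le_right hn) u hu
  rw [length_localizedModule_of_exact q hf hg h, mul_add]
  push_cast
  refine ⟨?_, ?_, ?_⟩
  · exact (length_ker_lsmul_le hf h _).trans ((add_le_add a₁ a₂).trans le_self_add)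
  · refine (length_quotSMulTop_le hg h _).trans ((add_le_add b₁ b₂).trans ?_)
    calc _ ≤ _ + (K₂ : ℕ∞) := le_self_add
      _ = _ := by ring
  · refine (add_le_add c₁ c₂).trans ?_
    rw [add_add_add_comm]
    calc _ ≤ Module.length R (QuotSMulTop (z + u * p ^ n) B) + K₂ + (K₁ + K₂) := by
          refine add_le_add ((length_quotSMulTop_add_le hf hg h _).trans ?_) le_rfl
          gcongr
      _ = _ := by ring

theorem eq_of_le_of_height_eq_one [IsDomain R] {P q : Ideal R} [P.IsPrime] [q.IsPrime] (hP : P ≠ ⊥)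
    (hq : q.height = 1) (h : P ≤ q) : P = q := by
  refine h.eq_or_lt.resolve_right fun hlt => ?_
  have h1 := Ideal.height_add_one_le_of_lt_of_isPrime hlt
  rw [hq] at h1
  refine hP (Ideal.height_eq_zero_iff_eq_bot.1 ?_)
  exact nonpos_iff_eq_zero.1 ((ENat.add_le_add_iff_right ENat.one_ne_top).1 (by simpa using h1))

theorem notMem_support_of_equiv_quotient [IsDomain R] (q : PrimeSpectrum R)
    (hq : q.asIdeal.height = 1)
    {M : Type*} [AddCommGroup M] [Module R M] (P : PrimeSpectrum R) (e : M ≃ₗ[R] R ⧸ P.asIdeal)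
    (hP : P.asIdeal ≠ ⊥) (hPq : P ≠ q) : q ∉ Module.support R M := by
  intro hmem
  rw [e.support_eq, Module.mem_support_iff_of_finite, Ideal.annihilator_quotient] at hmem
  exact hPq (PrimeSpectrum.ext (eq_of_le_of_height_eq_one hP hq hmem))

variable [IsDomain R] [IsNoetherianRing R] [IsLocalRing R]

theorem hasLinearSpecialization_of_equiv_quotient (hdim : ringKrullDim R = 2) (q : PrimeSpectrum R)
    (hq : q.asIdeal.height = 1) {p z : R} (hp : p ∈ maximalIdeal R) (hpq : p ∉ q.asIdeal)
    (hzq : z ∈ q.asIdeal) {M : Type*} [AddCommGroup M] [Module R M] (P : PrimeSpectrum R)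
    (e : M ≃ₗ[R] R ⧸ P.asIdeal) (hP : P.asIdeal ≠ ⊥)
    (hzP : z ∈ P.asIdeal → P = q ∨ P.asIdeal = maximalIdeal R) :
    HasLinearSpecialization q.asIdeal p z M := by
  have hquot : ∀ x : R, Module.length R (QuotSMulTop x M) =
      Ring.ord (R ⧸ P.asIdeal) (Ideal.Quotient.mk P.asIdeal x) := fun x =>
    (QuotSMulTop.congr x e).length_eq.trans (length_quotSMulTop_quotient _ _)
  have := krullDimLE_one_quotient hdim hP
  by_cases hPq : P = q
  · subst hPq
    refine ⟨0, 0, fun n _ u hu => ?_⟩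
    have hL : Module.length (Localization.AtPrime P.asIdeal)
        (LocalizedModule P.asIdeal.primeCompl M) = 1 := by
      rw [length_localizedModule_congr _ e, length_localizedModule_quotient_self]
    have hx : Ideal.Quotient.mk P.asIdeal (z + u * p ^ n) =
        Ideal.Quotient.mk P.asIdeal u * Ideal.Quotient.mk P.asIdeal p ^ n := by
      rw [map_add, Ideal.Quotient.eq_zero_iff_mem.2 hzq, zero_add, map_mul, map_pow]
    have hp0 : Ideal.Quotient.mk P.asIdeal p ≠ 0 := mt Ideal.Quotient.eq_zero_iff_mem.1 hpq
    have hxP : z + u * p ^ n ∉ P.asIdeal := by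
      rw [← Ideal.Quotient.eq_zero_iff_mem, hx]
      exact mul_ne_zero (hu.map _).ne_zero (pow_ne_zero _ hp0)
    rw [hL, hquot, hx, Ring.ord_mul_of_isUnit_left (hu.map (Ideal.Quotient.mk P.asIdeal)),
      Ring.ord_pow (mem_nonZeroDivisors_of_ne_zero hp0), nsmul_eq_mul]
    exact ⟨(length_ker_lsmul_quotient_eq_zero _ hxP e).le, by simp, by simp⟩
  · have hL := length_localizedModule_eq_zero q (notMem_support_of_equiv_quotient q hq P e hP hPq)
    simp only [HasLinearSpecialization, hL, mul_zero, zero_add, zero_le, and_true]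
    by_cases hz : z ∈ P.asIdeal
    -- Here `M` is the residue field. Multiplication by `z + u pⁿ` may be zero on it, so kernel and
    -- cokernel are both bounded by the length of `M`, which is one.
    · have hPm := (hzP hz).resolve_left hPq
      have hM : Module.length R M = 1 := by
        rw [e.length_eq, Module.length_eq_one_iff, isSimpleModule_iff_quot_maximal]
        exact ⟨P.asIdeal, hPm ▸ maximalIdeal.isMaximal R, ⟨LinearEquiv.refl _ _⟩⟩
      refine ⟨1, 0, fun n _ u _ => ?_⟩
      rw [Nat.cast_one, ← hM]
      exact ⟨Module.length_le_of_injective _ (Submodule.subtype_injective _),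
        Module.length_le_of_surjective _ (Submodule.mkQ_surjective _)⟩
    · have hz0 : Ideal.Quotient.mk P.asIdeal z ≠ 0 := mt Ideal.Quotient.eq_zero_iff_mem.1 hz
      obtain ⟨N, hN⟩ := exists_mk_add_mul_pow_eq (P := P.asIdeal) hp hz
      refine ⟨(Ring.ord (R ⧸ P.asIdeal) (Ideal.Quotient.mk P.asIdeal z)).toNat, N,
        fun n hn u _ => ?_⟩
      obtain ⟨v, hv, hx⟩ := hN n hn u
      have hxP : z + u * p ^ n ∉ P.asIdeal := by
        rw [← Ideal.Quotient.eq_zero_iff_mem, hx]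
        exact mul_ne_zero hz0 hv.ne_zero
      rw [hquot, hx, Ring.ord_mul_of_isUnit_right hv, length_ker_lsmul_quotient_eq_zero _ hxP e,
        ENat.natCast_toNat (Ring.ord_ne_top (mem_nonZeroDivisors_of_ne_zero hz0))]
      exact ⟨zero_le, le_rfl⟩

/-- The hypothesis is placed on the support because it then passes to submodules and quotients, as
the dévissage requires. -/
theorem hasLinearSpecialization (hdim : ringKrullDim R = 2) (q : PrimeSpectrum R)
    (hq : q.asIdeal.height = 1) {p z : R} (hp : p ∈ maximalIdeal R) (hpq : p ∉ q.asIdeal)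
    (hzq : z ∈ q.asIdeal) (M : Type*) [AddCommGroup M] [Module R M] [hM : Module.Finite R M]
    (hsupp : ∀ P ∈ Module.support R M, P.asIdeal ≠ ⊥ ∧
      (z ∈ P.asIdeal → P = q ∨ P.asIdeal = maximalIdeal R)) :
    HasLinearSpecialization q.asIdeal p z M := by
  revert hsupp
  induction hM using IsNoetherianRing.induction_on_isQuotientEquivQuotientPrime R with
  | subsingleton N =>
    intro _
    refine ⟨0, 0, fun n _ u _ => ?_⟩
    rw [length_localizedModule_eq_zero q (by simp [Module.support_eq_empty])]
    simp [Module.length_eq_zero]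
  | quotient N P e =>
    intro hsupp
    have hmem : P ∈ Module.support R N := by
      rw [e.support_eq, Module.mem_support_iff_of_finite, Ideal.annihilator_quotient]
    exact hasLinearSpecialization_of_equiv_quotient hdim q hq hp hpq hzq P e (hsupp P hmem).1
      (hsupp P hmem).2
  | exact N₁ N₂ N₃ f g hf hg h h₁ h₃ =>
    intro hsupp
    rw [Module.support_of_exact h hf hg] at hsupp
    exact .of_exact hf hg h (h₁ fun P hP => hsupp P (.inl hP)) (h₃ fun P hP => hsupp P (.inr hP))

-- Finiteness ensures that the `toNat` in `localLength` loses nothing: an infinite length would be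
-- read as `0`.
omit [IsLocalRing R] in
theorem length_localizedModule_ne_top (q : PrimeSpectrum R) (hq : q.asIdeal.height = 1)
    (M : Type*) [AddCommGroup M] [Module R M] [hM : Module.Finite R M]
    (hsupp : ∀ P ∈ Module.support R M, P.asIdeal ≠ ⊥) :
    Module.length (Localization.AtPrime q.asIdeal) (LocalizedModule q.asIdeal.primeCompl M) ≠
      ⊤ := by
  revert hsupp
  induction hM using IsNoetherianRing.induction_on_isQuotientEquivQuotientPrime R with
  | subsingleton N =>
    rw [length_localizedModule_eq_zero q (by simp [Module.support_eq_empty])]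
    simp
  | quotient N P e =>
    intro hsupp
    have hmem : P ∈ Module.support R N := by
      rw [e.support_eq, Module.mem_support_iff_of_finite, Ideal.annihilator_quotient]
    by_cases hPq : P = q
    · subst hPq
      rw [length_localizedModule_congr _ e, length_localizedModule_quotient_self]
      simp
    · rw [length_localizedModule_eq_zero q
        (notMem_support_of_equiv_quotient q hq P e (hsupp P hmem) hPq)]
      simp
  | exact N₁ N₂ N₃ f g hf hg h h₁ h₃ =>
    intro hsupp
    rw [Module.support_of_exact h hf hg] at hsupp
    rw [length_localizedModule_of_exact q.asIdeal hf hg h, ne_eq, ENat.add_eq_top, not_or]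
    exact ⟨h₁ fun P hP => hsupp P (.inl hP), h₃ fun P hP => hsupp P (.inr hP)⟩

end Asymptotics

/-! ### Localizing the characteristic ideal at height-one primes -/

section CharIdealLocalization

variable {R : Type*} [CommRing R] [IsDomain R]

theorem mem_one_div_iff {I : Ideal R} (hI : I ≠ ⊥) (x : FractionRing R) :
    x ∈ 1 / (I : FractionalIdeal R⁰ (FractionRing R)) ↔
      ∀ y ∈ I, ∃ r : R, algebraMap R _ r = x * algebraMap R _ y := by
  rw [FractionalIdeal.mem_div_iff_of_ne_zero (by simpa using hI)]
  simp [FractionalIdeal.mem_coeIdeal, FractionalIdeal.mem_one_iff]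

theorem mem_reflexiveClosure_iff {I : Ideal R} (hI : I ≠ ⊥) (x : R) :
    x ∈ reflexiveClosure I ↔
      ∀ w : FractionRing R, (∀ y ∈ I, ∃ r : R, algebraMap R _ r = w * algebraMap R _ y) →
        ∃ r : R, algebraMap R _ r = algebraMap R _ x * w := by
  have h0 : 1 / (I : FractionalIdeal R⁰ (FractionRing R)) ≠ 0 := by
    intro h
    have : (1 : FractionRing R) ∈ 1 / (I : FractionalIdeal R⁰ (FractionRing R)) :=
      (mem_one_div_iff hI 1).2 fun y _ => ⟨y, by simp⟩
    rw [h, FractionalIdeal.mem_zero_iff] at this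
    exact one_ne_zero this
  rw [reflexiveClosure, Submodule.mem_comap, Algebra.linearMap_apply, FractionalIdeal.mem_coe,
    FractionalIdeal.mem_div_iff_of_ne_zero h0]
  simp only [mem_one_div_iff hI, FractionalIdeal.mem_one_iff]

theorem le_reflexiveClosure {I : Ideal R} (hI : I ≠ ⊥) : I ≤ reflexiveClosure I := by
  intro x hx
  rw [mem_reflexiveClosure_iff hI]
  intro w hw
  obtain ⟨r, hr⟩ := hw x hx
  exact ⟨r, by rw [hr, mul_comm]⟩

/-- Reflexive closure does not change the localization at a prime where the ideal becomes
principal. -/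
theorem map_reflexiveClosure [IsNoetherianRing R] {I : Ideal R} (hI : I ≠ ⊥) (q : Ideal R)
    [q.IsPrime] (h : (I.map (algebraMap R (Localization.AtPrime q))).IsPrincipal) :
    (reflexiveClosure I).map (algebraMap R (Localization.AtPrime q)) =
      I.map (algebraMap R (Localization.AtPrime q)) := by
  refine le_antisymm ?_ (Ideal.map_mono (le_reflexiveClosure hI))
  set A := Localization.AtPrime q
  obtain ⟨g, hg⟩ := h.principal
  rw [Ideal.submodule_span_eq] at hg
  obtain ⟨⟨b, t⟩, hbt⟩ := IsLocalization.surj q.primeCompl g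
  have hinj : Function.Injective (algebraMap R A) :=
    IsLocalization.injective A q.primeCompl_le_nonZeroDivisors
  have htu : IsUnit (algebraMap R A t) := IsLocalization.map_units A t
  have hspan : I.map (algebraMap R A) = Ideal.span {algebraMap R A b} := by
    rw [hg, ← hbt, Ideal.span_singleton_mul_right_unit htu]
  have hb0 : b ≠ 0 := by
    rintro rfl
    rw [map_zero, Ideal.span_singleton_zero, Ideal.map_eq_bot_iff_of_injective hinj] at hspan
    exact hI hspan
  -- a common denominator for `I / b`
  have hex : ∃ s : q.primeCompl, ∀ y ∈ I, ∃ r : R, (s : R) * y = r * b := by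
    obtain ⟨S, hS⟩ := IsNoetherian.noetherian I
    have hloc : ∀ y ∈ I, ∃ s : q.primeCompl, ∃ r : R, (s : R) * y = r * b := by
      intro y hy
      have := Ideal.mem_map_of_mem (algebraMap R A) hy
      rw [hspan, Ideal.mem_span_singleton'] at this
      obtain ⟨c, hc⟩ := this
      obtain ⟨⟨r, s⟩, hrs⟩ := IsLocalization.surj q.primeCompl c
      refine ⟨s, r, hinj ?_⟩
      rw [map_mul, map_mul, ← hc, ← hrs]
      ring
    classical
    have hS' : ∀ T : Finset R, (T : Set R) ⊆ I → ∃ s : q.primeCompl, ∀ y ∈ T,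
        ∃ r : R, (s : R) * y = r * b := by
      intro T
      induction T using Finset.induction_on with
      | empty => intro _; exact ⟨1, by simp⟩
      | insert y T _ ih =>
        intro hT
        rw [Finset.coe_insert, Set.insert_subset_iff] at hT
        obtain ⟨s₁, r₁, h₁⟩ := hloc y hT.1
        obtain ⟨s₂, h₂⟩ := ih hT.2
        refine ⟨s₁ * s₂, fun y' hy' => ?_⟩
        rcases Finset.mem_insert.1 hy' with rfl | hy'
        · exact ⟨r₁ * s₂, by rw [Submonoid.coe_mul, mul_right_comm, h₁]; ring⟩
        · obtain ⟨r, hr⟩ := h₂ y' hy'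
          exact ⟨s₁ * r, by rw [Submonoid.coe_mul, mul_assoc, hr]; ring⟩
    obtain ⟨s, hs⟩ := hS' S (by rw [← hS]; exact Submodule.subset_span)
    refine ⟨s, fun y hy => ?_⟩
    rw [← hS] at hy
    induction hy using Submodule.span_induction with
    | mem y hy => exact hs y hy
    | zero => exact ⟨0, by simp⟩
    | add y₁ y₂ _ _ h₁ h₂ =>
      obtain ⟨r₁, h₁⟩ := h₁
      obtain ⟨r₂, h₂⟩ := h₂
      exact ⟨r₁ + r₂, by rw [mul_add, h₁, h₂]; ring⟩
    | smul a y _ h =>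
      obtain ⟨r, h⟩ := h
      exact ⟨a * r, by rw [smul_eq_mul, mul_left_comm, h]; ring⟩
  obtain ⟨s, hs⟩ := hex
  rw [Ideal.map_le_iff_le_comap]
  intro x hx
  rw [mem_reflexiveClosure_iff hI] at hx
  have hbK : algebraMap R (FractionRing R) b ≠ 0 :=
    (map_ne_zero_iff _ (IsFractionRing.injective R _)).2 hb0
  -- Since `s I ⊆ b R`, the fraction `s / b` lies in `R : I`. An element `x` of the reflexive
  -- closure thus satisfies `x s ∈ b R`, and `s` is a unit in the localization.
  obtain ⟨r, hr⟩ := hx (algebraMap R _ (s : R) / algebraMap R _ b) fun y hy => by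
    obtain ⟨r, hr⟩ := hs y hy
    refine ⟨r, ?_⟩
    rw [div_mul_eq_mul_div, eq_div_iff hbK, ← map_mul, ← map_mul, hr]
  rw [mul_div_assoc', eq_div_iff hbK, ← map_mul, ← map_mul] at hr
  have hr' := IsFractionRing.injective R (FractionRing R) hr
  rw [Ideal.mem_comap, hspan]
  have hsu : IsUnit (algebraMap R A s) := IsLocalization.map_units A s
  rw [← Ideal.mul_unit_mem_iff_mem _ hsu, ← map_mul, ← hr', map_mul]
  exact Ideal.mul_mem_left _ _ (Ideal.mem_span_singleton_self _)

variable [IsNoetherianRing R] [IsIntegrallyClosed R]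

theorem isDiscreteValuationRing_localization {q : Ideal R} [q.IsPrime] (hq : q.height = 1) :
    IsDiscreteValuationRing (Localization.AtPrime q) := by
  have hic : IsIntegrallyClosed (Localization.AtPrime q) :=
    isIntegrallyClosed_of_isLocalization (R := R) _ q.primeCompl q.primeCompl_le_nonZeroDivisors
  have hdim : ringKrullDim (Localization.AtPrime q) = 1 := by
    rw [IsLocalization.AtPrime.ringKrullDim_eq_height q, hq]
    rfl
  have hnf : ¬ IsField (Localization.AtPrime q) := by
    intro h
    rw [ringKrullDim_eq_zero_of_isField h] at hdim
    exact zero_ne_one hdim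
  have : Ring.KrullDimLE 1 (Localization.AtPrime q) := by
    rw [Ring.KrullDimLE, Order.krullDimLE_iff]
    exact hdim.le
  refine ((IsDiscreteValuationRing.TFAE _ hnf).out 0 2).2 ?_
  exact { hic with maximalOfPrime := fun hp hP => hP.isMaximal_of_ne_bot hp }

variable (M : Type*) [AddCommGroup M] [Module R M] [Module.Finite R M]

omit [IsNoetherianRing R] [IsIntegrallyClosed R] [Module.Finite R M] in
theorem ne_bot_of_mem_support (hM : Module.IsTorsion R M) {P : PrimeSpectrum R}
    (hP : P ∈ Module.support R M) : P.asIdeal ≠ ⊥ := by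
  intro h
  obtain ⟨m, hm⟩ := Module.mem_support_iff_exists_annihilator.1 hP
  obtain ⟨⟨a, ha⟩, hma⟩ := @hM m
  have : a ∈ P.asIdeal := hm (Submodule.mem_annihilator_span_singleton _ _ |>.2 hma)
  rw [h, Ideal.mem_bot] at this
  exact nonZeroDivisors.ne_zero ha this

omit [IsDomain R] [IsNoetherianRing R] [IsIntegrallyClosed R] [Module.Finite R M] in
variable {M} in
theorem localLength_ne_zero_of_mem_support {P : PrimeSpectrum R} (hP : P ∈ Module.support R M)
    (h : Module.length (Localization.AtPrime P.asIdeal)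
      (LocalizedModule P.asIdeal.primeCompl M) ≠ ⊤) : localLength R M P.asIdeal ≠ 0 := by
  have hnt : Nontrivial (LocalizedModule P.asIdeal.primeCompl M) := Module.mem_support_iff.1 hP
  rw [localLength, ne_eq, ENat.toNat_eq_zero, not_or]
  exact ⟨Module.length_pos.ne', h⟩

-- The support of a torsion module omits the zero ideal, so a height-one prime in it is minimal over
-- the annihilator, and there are finitely many of those.
omit [IsIntegrallyClosed R] in
theorem finite_setOf_localLength_ne_zero (hM : Module.IsTorsion R M) :
    {P : PrimeSpectrum R | P.asIdeal.height = 1 ∧ localLength R M P.asIdeal ≠ 0}.Finite := by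
  refine Set.Finite.of_finite_image (f := PrimeSpectrum.asIdeal) ?_
    (fun _ _ _ _ h => PrimeSpectrum.ext h)
  refine (Ideal.finite_minimalPrimes_of_isNoetherianRing R (Module.annihilator R M)).subset ?_
  rintro _ ⟨P, ⟨hP, hl⟩, rfl⟩
  have hsupp : P ∈ Module.support R M := by
    by_contra h
    exact hl (by rw [localLength, length_localizedModule_eq_zero P h]; rfl)
  refine ⟨⟨P.2, Module.mem_support_iff_of_finite.1 hsupp⟩, fun Q ⟨hQ, hQa⟩ hQP => ?_⟩
  have hQs : (⟨Q, hQ⟩ : PrimeSpectrum R) ∈ Module.support R M :=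
    Module.mem_support_iff_of_finite.2 hQa
  exact (eq_of_le_of_height_eq_one (ne_bot_of_mem_support M hM hQs) hP hQP).ge

theorem map_charIdeal (hM : Module.IsTorsion R M) (q : PrimeSpectrum R)
    (hq : q.asIdeal.height = 1) :
    (charIdeal R M).map (algebraMap R (Localization.AtPrime q.asIdeal)) =
      maximalIdeal (Localization.AtPrime q.asIdeal) ^ localLength R M q.asIdeal := by
  classical
  have := isDiscreteValuationRing_localization hq
  let q' : {P : PrimeSpectrum R // P.asIdeal.height = 1} := ⟨q, hq⟩
  -- If the support were infinite, `finprod` would take the default value `1`.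
  have hfin : Set.Finite (Function.mulSupport
      fun P : {P : PrimeSpectrum R // P.asIdeal.height = 1} =>
        P.1.asIdeal ^ localLength R M P.1.asIdeal) := by
    refine Set.Finite.of_finite_image (f := Subtype.val)
      ((finite_setOf_localLength_ne_zero M hM).subset ?_) Subtype.val_injective.injOn
    rintro _ ⟨P, hP, rfl⟩
    refine ⟨P.2, fun h => hP ?_⟩
    simp only [h, pow_zero]
  rw [charIdeal, if_pos hM]
  have hI : (∏ᶠ P : {P : PrimeSpectrum R // P.asIdeal.height = 1},
      P.1.asIdeal ^ localLength R M P.1.asIdeal) ≠ ⊥ := by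
    rw [finprod_eq_prod _ hfin, ← Ideal.zero_eq_bot, Finset.prod_ne_zero_iff]
    exact fun P _ => pow_ne_zero _ (Ideal.ne_bot_of_height_eq_one P.2)
  have hmap : (∏ᶠ P : {P : PrimeSpectrum R // P.asIdeal.height = 1},
      P.1.asIdeal ^ localLength R M P.1.asIdeal).map
        (algebraMap R (Localization.AtPrime q.asIdeal)) =
      maximalIdeal (Localization.AtPrime q.asIdeal) ^ localLength R M q.asIdeal := by
    have h1 := MonoidHom.map_finprod
      (Ideal.mapHom (algebraMap R (Localization.AtPrime q.asIdeal)) :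
        Ideal R →* Ideal (Localization.AtPrime q.asIdeal)) hfin
    refine Eq.trans h1 ?_
    rw [finprod_eq_single _ q']
    · change Ideal.map _ (q.asIdeal ^ _) = _
      rw [Ideal.map_pow, Localization.AtPrime.map_eq_maximalIdeal]
    · intro P hP
      change Ideal.map _ (P.1.asIdeal ^ _) = _
      rw [Ideal.map_pow]
      have : P.1.asIdeal.map (algebraMap R (Localization.AtPrime q.asIdeal)) = ⊤ := by
        have hnle : ¬ P.1.asIdeal ≤ q.asIdeal := fun h => hP (Subtype.ext (PrimeSpectrum.ext
          (eq_of_le_of_height_eq_one (Ideal.ne_bot_of_height_eq_one P.2) hq h)))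
        obtain ⟨s, hsP, hsq⟩ := SetLike.not_le_iff_exists.1 hnle
        exact Ideal.eq_top_of_isUnit_mem _ (Ideal.mem_map_of_mem _ hsP)
          (IsLocalization.map_units _ (⟨s, hsq⟩ : q.asIdeal.primeCompl))
      rw [this, ← Ideal.one_eq_top, one_pow]
  rw [map_reflexiveClosure hI q.asIdeal (IsPrincipalIdealRing.principal _), hmap]

theorem charIdealLEOutside_iff (N : Type*) [AddCommGroup N] [Module R N] [Module.Finite R N]
    (hM : Module.IsTorsion R M) (hN : Module.IsTorsion R N) (p : ℕ) :
    CharIdealLEOutside R p N M ↔ ∀ P : PrimeSpectrum R, P.asIdeal.height = 1 →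
      (p : R) ∉ P.asIdeal → localLength R M P.asIdeal ≤ localLength R N P.asIdeal := by
  refine forall_congr' fun P => forall_congr' fun hP => forall_congr' fun _ => ?_
  have := isDiscreteValuationRing_localization hP
  rw [map_charIdeal M hM P hP, map_charIdeal N hN P hP]
  refine ⟨fun h => ?_, fun h => Ideal.pow_le_pow_right h⟩
  by_contra! hlt
  have h1 : maximalIdeal (Localization.AtPrime P.asIdeal) ^ localLength R N P.asIdeal ≤
      maximalIdeal (Localization.AtPrime P.asIdeal) ^ (localLength R N P.asIdeal + 1) :=
    h.trans (Ideal.pow_le_pow_right hlt)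
  exact absurd h1 (Ideal.pow_succ_lt_pow (IsDiscreteValuationRing.not_a_field _) _).not_ge

end CharIdealLocalization

/-! ### From lengths to cardinalities, and from ideals to exponents -/

section Specialization

variable {R : Type*} [CommRing R] [IsLocalRing R]

theorem IsParameterPair.eq_maximalIdeal {x y : R} (h : IsParameterPair x y) {P : Ideal R}
    (hP : P.IsPrime) (hx : x ∈ P) (hy : y ∈ P) : P = maximalIdeal R := by
  refine le_antisymm (le_maximalIdeal hP.ne_top) ?_
  rw [← h, hP.radical_le_iff, Ideal.span_le]
  rintro w (rfl | rfl)
  exacts [hx, hy]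

theorem IsParameterPair.mem_maximalIdeal {x y : R} (h : IsParameterPair x y) :
    x ∈ maximalIdeal R ∧ y ∈ maximalIdeal R := by
  rw [← h]
  exact ⟨Ideal.le_radical (Ideal.subset_span (by simp)),
    Ideal.le_radical (Ideal.subset_span (by simp))⟩

theorem isUnit_sub_mul {u v x : R} (hu : IsUnit u) (hx : x ∈ maximalIdeal R) :
    IsUnit (u - v * x) := by
  by_contra h
  have h1 := Ideal.add_mem _ ((IsLocalRing.mem_maximalIdeal _).2 h) (Ideal.mul_mem_left _ v hx)
  rw [sub_add_cancel] at h1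
  exact (IsLocalRing.mem_maximalIdeal _).1 h1 hu

theorem height_maximalIdeal_eq_two (hdim : ringKrullDim R = 2) : (maximalIdeal R).height = 2 :=
  WithBot.coe_injective (by rw [maximalIdeal_height_eq_ringKrullDim, hdim]; rfl)

variable [IsNoetherianRing R]

/-- If the ideals agreed, the difference of the generators, a unit times `p ^ m`, would lie in the
common ideal, and hence so would `z`. The maximal ideal would then be minimal over a principal
ideal, contradicting Krull's height theorem in dimension two. -/
theorem span_add_mul_pow_ne (hdim : ringKrullDim R = 2) {p z : R} (h : IsParameterPair p z)
    {u v : R} (hu : IsUnit u) {m n : ℕ} (hm : 0 < m) (hmn : m < n) :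
    Ideal.span {z + u * p ^ m} ≠ Ideal.span {z + v * p ^ n} := by
  intro heq
  obtain ⟨hp, hz⟩ := h.mem_maximalIdeal
  set I := Ideal.span {z + u * p ^ m} with hI
  have h1 : z + u * p ^ m ∈ I := Ideal.mem_span_singleton_self _
  have h2 : z + v * p ^ n ∈ I := heq ▸ Ideal.mem_span_singleton_self _
  have h3 : p ^ m ∈ I := by
    have h4 := Ideal.sub_mem _ h1 h2
    have hn : p ^ n = p ^ (n - m) * p ^ m := by rw [← pow_add]; congr 1; omega
    have h5 : z + u * p ^ m - (z + v * p ^ n) = (u - v * p ^ (n - m)) * p ^ m := by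
      rw [hn]; ring
    rw [h5] at h4
    exact (Ideal.unit_mul_mem_iff_mem _
      (isUnit_sub_mul hu (Ideal.pow_mem_of_mem _ hp _ (by omega)))).1 h4
  have h6 : z ∈ I := by
    have := Ideal.sub_mem _ h1 (Ideal.mul_mem_left _ u h3)
    rwa [add_sub_cancel_right] at this
  have hmin : maximalIdeal R ∈ I.minimalPrimes := by
    refine ⟨⟨inferInstance, ?_⟩, fun Q ⟨hQ, hIQ⟩ _ => ?_⟩
    · rw [hI, Ideal.span_singleton_le_iff_mem]
      exact Ideal.add_mem _ hz (Ideal.mul_mem_left _ _ (Ideal.pow_mem_of_mem _ hp _ hm))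
    · exact (h.eq_maximalIdeal hQ (hQ.mem_of_pow_mem _ (hIQ h3)) (hIQ h6)).ge
  have hle := Ideal.height_le_one_of_isPrincipal_of_mem_minimalPrimes I (maximalIdeal R) hmin
  rw [height_maximalIdeal_eq_two hdim] at hle
  exact absurd hle (by decide)

omit [IsNoetherianRing R] in
theorem height_eq_one [IsDomain R] (hdim : ringKrullDim R = 2) {P : Ideal R} [P.IsPrime]
    (hP : P ≠ ⊥) (hPm : P ≠ maximalIdeal R) : P.height = 1 := by
  have hlt : P < maximalIdeal R := (le_maximalIdeal Ideal.IsPrime.ne_top').lt_of_ne hPm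
  have h1 := Ideal.height_add_one_le_of_lt_of_isPrime hlt
  rw [height_maximalIdeal_eq_two hdim] at h1
  refine le_antisymm ((ENat.add_le_add_iff_right ENat.one_ne_top).1
    (h1.trans_eq one_add_one_eq_two.symm)) ?_
  rw [Order.one_le_iff_ne_zero, ne_eq, Ideal.height_eq_zero_iff_eq_bot]
  exact hP

section Units

variable (p : ℕ) [Fact p.Prime] [CharP (ResidueField R) p] [PerfectRing (ResidueField R) p]
  [IsAdicComplete (maximalIdeal R) R]

omit [IsNoetherianRing R] in
theorem finite_setOf_mem_specializationIdeals {k : ℕ} (z : Fin k → R)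
    (a : ℕ → (WittVector p (ResidueField R))ˣ) {Q : Ideal R → Prop}
    (h : ∀ t, ∃ N, ∀ n, N ≤ n → Q (Ideal.span {z t + wittMap R p (a n) * (p : R) ^ n})) :
    {I ∈ ⋃ t, specializationIdeals p (z t) a | ¬ Q I}.Finite := by
  choose N hN using h
  refine (Set.finite_iUnion fun t => (Set.finite_Iio (N t)).image
    fun n => Ideal.span {z t + wittMap R p (a n) * (p : R) ^ n}).subset ?_
  rintro I ⟨hI, hQ⟩
  obtain ⟨t, n, _, rfl⟩ := Set.mem_iUnion.1 hI
  exact Set.mem_iUnion.2 ⟨t, n, lt_of_not_ge fun hn => hQ (hN t n hn), rfl⟩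

/-- A finite set of exceptional ideals excludes only finitely many `n`, because `n` is determined by
its ideal. -/
theorem exists_forall_of_finite (hdim : ringKrullDim R = 2) {k : ℕ} {z : Fin k → R}
    {a : ℕ → (WittVector p (ResidueField R))ˣ} {Q : Ideal R → Prop}
    (h : {I ∈ ⋃ t, specializationIdeals p (z t) a | ¬ Q I}.Finite) (t : Fin k)
    (hz : IsParameterPair (p : R) (z t)) :
    ∃ N, ∀ n, N ≤ n → Q (Ideal.span {z t + wittMap R p (a n) * (p : R) ^ n}) := by
  have hu : ∀ n, IsUnit (wittMap R p (a n)) := fun n => (a n).isUnit.map _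
  have hinj : Set.InjOn (fun n => Ideal.span {z t + wittMap R p (a n) * (p : R) ^ n})
      (Set.Ioi 0) := by
    intro m hm n hn heq
    rcases lt_trichotomy m n with hlt | rfl | hlt
    · exact absurd heq (span_add_mul_pow_ne hdim hz (hu m) hm hlt)
    · rfl
    · exact absurd heq.symm (span_add_mul_pow_ne hdim hz (hu n) hn hlt)
  have hfin : {n | 0 < n ∧ ¬ Q (Ideal.span {z t + wittMap R p (a n) * (p : R) ^ n})}.Finite := by
    refine Set.Finite.of_finite_image (h.subset ?_) (hinj.mono fun n hn => hn.1)
    rintro _ ⟨n, ⟨hn, hQ⟩, rfl⟩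
    exact ⟨Set.mem_iUnion.2 ⟨t, n, hn, rfl⟩, hQ⟩
  obtain ⟨B, hB⟩ := hfin.bddAbove
  refine ⟨B + 1, fun n hn => by_contra fun hQ => ?_⟩
  have := hB (show n ∈ {n | 0 < n ∧ _} from ⟨by omega, hQ⟩)
  omega

end Units

variable [IsDomain R] [Finite (ResidueField R)]

omit [IsNoetherianRing R] [IsDomain R] in
theorem HasLinearSpecialization.exists_card_eq {q : Ideal R} [q.IsPrime] {p z : R} {M : Type*}
    [AddCommGroup M] [Module R M] (h : HasLinearSpecialization q p z M)
    (hL : Module.length (Localization.AtPrime q) (LocalizedModule q.primeCompl M) ≠ ⊤)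
    {d : ℕ} (hd : Ring.ord (R ⧸ q) (Ideal.Quotient.mk q p) = d) :
    ∃ K N : ℕ, ∀ n, N ≤ n → ∀ u : R, IsUnit u → ∃ a : ℕ,
      Finite (M ⧸ (Ideal.span {z + u * p ^ n} • ⊤ : Submodule R M)) ∧
      Nat.card (M ⧸ (Ideal.span {z + u * p ^ n} • ⊤ : Submodule R M)) =
        Nat.card (ResidueField R) ^ a ∧
      a ≤ n * d * localLength R M q + K ∧ n * d * localLength R M q ≤ a + K := by
  obtain ⟨K, N, h⟩ := h
  refine ⟨K, N, fun n hn u hu => ?_⟩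
  obtain ⟨-, h1, h2⟩ := h n hn u hu
  rw [hd, ← ENat.natCast_toNat hL] at h1 h2
  have hne : Module.length R (QuotSMulTop (z + u * p ^ n) M) ≠ ⊤ :=
    ne_top_of_le_ne_top (by norm_cast; exact ENat.natCast_ne_top _) h1
  obtain ⟨hf, hc⟩ := finite_and_card_of_length_ne_top hne
  rw [Submodule.ideal_span_singleton_smul]
  refine ⟨_, hf, hc, ?_, ?_⟩
  · rw [← ENat.natCast_toNat hne] at h1
    exact_mod_cast h1
  · rw [← ENat.natCast_toNat hne] at h2
    exact_mod_cast h2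

-- Positivity of `d` makes a difference of local lengths visible as growth in `n`; it holds because
-- `p` is a nonunit in `R/q`.
omit [Finite (ResidueField R)] in
theorem exists_ord_eq (hdim : ringKrullDim R = 2) {q : Ideal R} [q.IsPrime] (hq : q ≠ ⊥) {p : R}
    (hp : p ∈ maximalIdeal R) (hpq : p ∉ q) :
    ∃ d : ℕ, 0 < d ∧ Ring.ord (R ⧸ q) (Ideal.Quotient.mk q p) = d := by
  have := krullDimLE_one_quotient hdim hq
  have hp0 : Ideal.Quotient.mk q p ≠ 0 := mt Ideal.Quotient.eq_zero_iff_mem.1 hpq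
  obtain ⟨d, hd⟩ := ENat.ne_top_iff_exists.1 (Ring.ord_ne_top (mem_nonZeroDivisors_of_ne_zero hp0))
  refine ⟨d, ?_, hd.symm⟩
  have hpos : 0 < Ring.ord (R ⧸ q) (Ideal.Quotient.mk q p) := by
    rw [Ring.ord, Module.length_pos_iff, Submodule.Quotient.nontrivial_iff, ne_eq,
      Ideal.span_singleton_eq_top]
    intro hu
    obtain ⟨y, hy⟩ := hu.exists_right_inv
    obtain ⟨y, rfl⟩ := Ideal.Quotient.mk_surjective y
    rw [← map_mul, ← map_one (Ideal.Quotient.mk q), eq_comm, Ideal.Quotient.eq] at hy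
    have h1 := Ideal.add_mem _ (le_maximalIdeal Ideal.IsPrime.ne_top' hy)
      (Ideal.mul_mem_right y _ hp)
    rw [sub_add_cancel] at h1
    exact (Ideal.ne_top_iff_one _).1 (maximalIdeal.isMaximal R).ne_top h1
  rw [← hd] at hpos
  exact_mod_cast hpos

omit [IsNoetherianRing R] [IsDomain R] in
theorem isIntegralRatio_of_card_eq {M N : Type*} [AddCommGroup M] [Module R M] [AddCommGroup N]
    [Module R N] {I : Ideal R} {a b C : ℕ}
    (ha : Nat.card (M ⧸ (I • ⊤ : Submodule R M)) = Nat.card (ResidueField R) ^ a)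
    (hb : Nat.card (N ⧸ (I • ⊤ : Submodule R N)) = Nat.card (ResidueField R) ^ b)
    (h : a ≤ C + b) : IsIntegralRatio M N (Nat.card (ResidueField R) ^ C) I := by
  have h0 : (Nat.card (ResidueField R) : ℚ) ≠ 0 := by exact_mod_cast Nat.card_pos.ne'
  refine ⟨Nat.card (ResidueField R) ^ (C + b - a), ?_⟩
  rw [ha, hb]
  push_cast
  rw [mul_div_assoc', div_eq_iff (pow_ne_zero _ h0), ← pow_add, ← pow_add, Nat.sub_add_cancel h]

-- Integrality reads `c · |𝔽| ^ b = m · |𝔽| ^ a` with `m > 0`, and the crude bound `c < |𝔽| ^ c`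
-- suffices to compare exponents.
omit [IsNoetherianRing R] [IsDomain R] in
theorem IsIntegralRatio.le_add {M N : Type*} [AddCommGroup M] [Module R M] [AddCommGroup N]
    [Module R N] {I : Ideal R} {a b c : ℕ} (hc : 0 < c)
    (ha : Nat.card (M ⧸ (I • ⊤ : Submodule R M)) = Nat.card (ResidueField R) ^ a)
    (hb : Nat.card (N ⧸ (I • ⊤ : Submodule R N)) = Nat.card (ResidueField R) ^ b)
    (h : IsIntegralRatio M N c I) : a ≤ c + b := by
  have h0 : (Nat.card (ResidueField R) : ℚ) ≠ 0 := by exact_mod_cast Nat.card_pos.ne'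
  have h1 : 1 < Nat.card (ResidueField R) := Finite.one_lt_card
  obtain ⟨m, hm⟩ := h
  rw [ha, hb] at hm
  push_cast at hm
  rw [mul_div_assoc', div_eq_iff (pow_ne_zero _ h0)] at hm
  have hm' : c * Nat.card (ResidueField R) ^ b = m * Nat.card (ResidueField R) ^ a := by
    exact_mod_cast hm
  have hm0 : 0 < m := by
    rcases Nat.eq_zero_or_pos m with rfl | h
    · have : 0 < c * Nat.card (ResidueField R) ^ b := by positivity
      omega
    · exact h
  refine (Nat.pow_le_pow_iff_right h1).1 ?_
  calc _ ≤ m * Nat.card (ResidueField R) ^ a := Nat.le_mul_of_pos_left _ hm0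
    _ = c * Nat.card (ResidueField R) ^ b := hm'.symm
    _ ≤ Nat.card (ResidueField R) ^ c * Nat.card (ResidueField R) ^ b := by
      gcongr
      exact (Nat.lt_pow_self h1).le
    _ = _ := (pow_add _ _ _).symm

end Specialization

end Specialization

/-! ### The main theorem -/

open Specialization IsLocalRing in
theorem mainTheorem2 {R : Type*} [CommRing R] [IsDomain R] [IsNoetherianRing R] [IsLocalRing R]
    [IsIntegrallyClosed R] [IsAdicComplete (IsLocalRing.maximalIdeal R) R]
    (hdim : ringKrullDim R = 2) [CharZero R] (p : ℕ) [Fact p.Prime]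
    [CharP (IsLocalRing.ResidueField R) p] [Finite (IsLocalRing.ResidueField R)]
    (M N : Type*) [AddCommGroup M] [Module R M] [Module.Finite R M]
    [AddCommGroup N] [Module R N] [Module.Finite R N]
    (hM : Module.IsTorsion R M) (hN : Module.IsTorsion R N)
    (k : ℕ) (q : Fin k → PrimeSpectrum R) (hq : Function.Injective q)
    (hq_range : Set.range q = {P : PrimeSpectrum R | P.asIdeal.height = 1 ∧ (p : R) ∉ P.asIdeal ∧
      (Specialization.localLength R M P.asIdeal ≠ 0 ∨
        Specialization.localLength R N P.asIdeal ≠ 0)})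
    (z : Fin k → R) (hz_param : ∀ t, Specialization.IsParameterPair (p : R) (z t))
    (hz_mem : ∀ t, z t ∈ (q t).asIdeal) (hz_notMem : ∀ t i, i ≠ t → z t ∉ (q i).asIdeal) :
    (∀ a : ℕ → (WittVector p (IsLocalRing.ResidueField R))ˣ,
      {I ∈ ⋃ i, Specialization.specializationIdeals p (z i) a |
        ¬ (Finite (M ⧸ (I • ⊤ : Submodule R M)) ∧
          Finite (N ⧸ (I • ⊤ : Submodule R N)))}.Finite) ∧
    (Specialization.CharIdealLEOutside R p N M ↔
      ∃ c : ℕ, 0 < c ∧ ∀ a : ℕ → (WittVector p (IsLocalRing.ResidueField R))ˣ,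
        {I ∈ ⋃ i, Specialization.specializationIdeals p (z i) a |
          ¬ Specialization.IsIntegralRatio M N c I}.Finite) ∧
    ∀ a : ℕ → (WittVector p (IsLocalRing.ResidueField R))ˣ,
      (Specialization.CharIdealLEOutside R p N M ↔
        ∃ c : ℕ, 0 < c ∧
          {I ∈ ⋃ i, Specialization.specializationIdeals p (z i) a |
            ¬ Specialization.IsIntegralRatio M N c I}.Finite) := by
  have hp : (p : R) ∈ maximalIdeal R := natCast_mem_maximalIdeal R p
  have hqt : ∀ t, (q t).asIdeal.height = 1 ∧ (p : R) ∉ (q t).asIdeal := fun t => by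
    have : q t ∈ Set.range q := ⟨t, rfl⟩
    rw [hq_range] at this
    exact ⟨this.1, this.2.1⟩
  -- Suppose a nonmaximal such `P` contains `z t`. Then `p ∉ P`, as `(p, z t)` is a parameter ideal,
  -- so `P` is some `q i`, and `z t ∉ q i` for `i ≠ t` forces `i = t`.
  have hsupp : ∀ t (P : PrimeSpectrum R), P.asIdeal ≠ ⊥ →
      (P.asIdeal.height = 1 → localLength R M P.asIdeal ≠ 0 ∨ localLength R N P.asIdeal ≠ 0) →
      z t ∈ P.asIdeal → P = q t ∨ P.asIdeal = maximalIdeal R := by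
    intro t P hP hl hz
    by_contra! hne
    have hh := height_eq_one hdim hP hne.2
    have hmem : P ∈ Set.range q := by
      rw [hq_range]
      exact ⟨hh, fun hpP => hne.2 ((hz_param t).eq_maximalIdeal P.2 hpP hz), hl hh⟩
    obtain ⟨i, rfl⟩ := hmem
    exact hz_notMem t i (fun h => hne.1 (by rw [h])) hz
  have hMt := fun P (hP : P.asIdeal.height = 1) => length_localizedModule_ne_top P hP M
    fun P hP => ne_bot_of_mem_support M hM hP
  have hNt := fun P (hP : P.asIdeal.height = 1) => length_localizedModule_ne_top P hP N
    fun P hP => ne_bot_of_mem_support N hN hP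
  have hcard : ∀ t, ∃ K n₀ d : ℕ, 0 < d ∧ ∀ n, n₀ ≤ n → ∀ u : R, IsUnit u → ∃ a b : ℕ,
      (Finite (M ⧸ (Ideal.span {z t + u * (p : R) ^ n} • ⊤ : Submodule R M)) ∧
        Finite (N ⧸ (Ideal.span {z t + u * (p : R) ^ n} • ⊤ : Submodule R N))) ∧
      Nat.card (M ⧸ (Ideal.span {z t + u * (p : R) ^ n} • ⊤ : Submodule R M)) =
        Nat.card (ResidueField R) ^ a ∧
      Nat.card (N ⧸ (Ideal.span {z t + u * (p : R) ^ n} • ⊤ : Submodule R N)) =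
        Nat.card (ResidueField R) ^ b ∧
      a ≤ n * d * localLength R M (q t).asIdeal + K ∧
      n * d * localLength R M (q t).asIdeal ≤ a + K ∧
      b ≤ n * d * localLength R N (q t).asIdeal + K ∧
      n * d * localLength R N (q t).asIdeal ≤ b + K := by
    intro t
    obtain ⟨d, hd, hord⟩ := exists_ord_eq hdim (Ideal.ne_bot_of_height_eq_one (hqt t).1) hp
      (hqt t).2
    have hlin₁ := hasLinearSpecialization hdim (q t) (hqt t).1 hp (hqt t).2 (hz_mem t) M
      fun P hP => ⟨ne_bot_of_mem_support M hM hP, hsupp t P (ne_bot_of_mem_support M hM hP)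
        fun hh => .inl (localLength_ne_zero_of_mem_support hP (hMt P hh))⟩
    have hlin₂ := hasLinearSpecialization hdim (q t) (hqt t).1 hp (hqt t).2 (hz_mem t) N
      fun P hP => ⟨ne_bot_of_mem_support N hN hP, hsupp t P (ne_bot_of_mem_support N hN hP)
        fun hh => .inr (localLength_ne_zero_of_mem_support hP (hNt P hh))⟩
    obtain ⟨K₁, n₁, h₁⟩ := hlin₁.exists_card_eq (hMt _ (hqt t).1) hord
    obtain ⟨K₂, n₂, h₂⟩ := hlin₂.exists_card_eq (hNt _ (hqt t).1) hord
    refine ⟨K₁ + K₂, max n₁ n₂, d, hd, fun n hn u hu => ?_⟩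
    obtain ⟨a, ha, ha', ha₁, ha₂⟩ := h₁ n (le_of_max_le_left hn) u hu
    obtain ⟨b, hb, hb', hb₁, hb₂⟩ := h₂ n (le_of_max_le_right hn) u hu
    exact ⟨a, b, ⟨ha, hb⟩, ha', hb', by omega, by omega, by omega, by omega⟩
  choose K n₀ d hd hcard using hcard
  have hunit : ∀ (a : ℕ → (WittVector p (ResidueField R))ˣ) n, IsUnit (wittMap R p (a n)) :=
    fun a n => (a n).isUnit.map _
  have hforward : CharIdealLEOutside R p N M →
      ∃ c : ℕ, 0 < c ∧ ∀ a : ℕ → (WittVector p (ResidueField R))ˣ,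
        {I ∈ ⋃ i, specializationIdeals p (z i) a | ¬ IsIntegralRatio M N c I}.Finite := by
    rw [charIdealLEOutside_iff M N hM hN]
    intro h
    -- Each of `M` and `N` contributes an error `K t`; the sum over `t` serves as a common bound for
    -- all `2 * K t`. None of this involves the sequence `a`.
    refine ⟨Nat.card (ResidueField R) ^ ∑ t, 2 * K t, pow_pos Nat.card_pos _, fun a =>
      finite_setOf_mem_specializationIdeals p z a fun t => ⟨n₀ t, fun n hn => ?_⟩⟩
    obtain ⟨i, j, -, hi, hj, hi₁, -, -, hj₂⟩ := hcard t n hn _ (hunit a n)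
    refine isIntegralRatio_of_card_eq hi hj ?_
    have h1 : n * d t * localLength R M (q t).asIdeal ≤ n * d t * localLength R N (q t).asIdeal :=
      Nat.mul_le_mul_left _ (h (q t) (hqt t).1 (hqt t).2)
    have h2 : 2 * K t ≤ ∑ t, 2 * K t :=
      Finset.single_le_sum (f := fun t => 2 * K t) (fun _ _ => Nat.zero_le _) (Finset.mem_univ t)
    omega
  have hbackward : ∀ (a : ℕ → (WittVector p (ResidueField R))ˣ) (c : ℕ), 0 < c →
      {I ∈ ⋃ i, specializationIdeals p (z i) a | ¬ IsIntegralRatio M N c I}.Finite →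
      CharIdealLEOutside R p N M := by
    intro a c hc hfin
    rw [charIdealLEOutside_iff M N hM hN]
    intro P hP hpP
    -- Only primes with nonzero local length of `M` need an argument, and these are among the `q t`.
    by_cases h0 : localLength R M P.asIdeal = 0
    · rw [h0]; exact Nat.zero_le _
    obtain ⟨t, rfl⟩ : P ∈ Set.range q := by rw [hq_range]; exact ⟨hP, hpP, .inl h0⟩
    obtain ⟨n₁, hn₁⟩ := exists_forall_of_finite p hdim hfin t (hz_param t)
    by_contra! hlt
    -- If the inequality failed at `q t`, the estimates would give `n ≤ n * d t ≤ c + 2 * K t`,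
    -- which this choice of `n` violates.
    set n := max (max (n₀ t) n₁) (c + 2 * K t + 1) with hn
    obtain ⟨i, j, -, hi, hj, -, hi₂, hj₁, -⟩ := hcard t n (by omega) _ (hunit a n)
    have h1 := (hn₁ n (by omega)).le_add hc hi hj
    have h2 : n * d t * (localLength R N (q t).asIdeal + 1) ≤
        n * d t * localLength R M (q t).asIdeal := Nat.mul_le_mul_left _ hlt
    have h3 : n ≤ n * d t := Nat.le_mul_of_pos_right _ (hd t)
    rw [mul_add, mul_one] at h2
    omega
  refine ⟨fun a => finite_setOf_mem_specializationIdeals p z a (Q := fun I =>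
      Finite (M ⧸ (I • ⊤ : Submodule R M)) ∧ Finite (N ⧸ (I • ⊤ : Submodule R N)))
      fun t => ⟨n₀ t, fun n hn => ?_⟩, ⟨hforward, ?_⟩, fun a => ⟨fun h => ?_, ?_⟩⟩
  · obtain ⟨_, _, h, -⟩ := hcard t n hn _ (hunit a n)
    exact h
  · rintro ⟨c, hc, h⟩
    -- One sequence suffices for this direction; the constant sequence `1` is taken.
    exact hbackward 1 c hc (h 1)
  · obtain ⟨c, hc, h⟩ := hforward h
    exact ⟨c, hc, h a⟩
  · rintro ⟨c, hc, h⟩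
    exact hbackward a c hc h
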